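/- We use the standard notions of computability logic. A constant game $A$ is given by a set of legal runs (finite or infinite sequences of moves, each labeled by the machine $\top$ or the environment $\bot$; a run is legal iff all its finite initial segments are) and a function assigning to each run its winner, where an illegal run is lost by the player who made the first illegal move. $A$ is static iff, whenever a run $\Gamma$ is won by a player $\wp$ and $\Delta$ is a $\wp$-delay of $\Gamma$ (each player makes the same moves in the same order in $\Delta$ as in $\Gamma$, and whenever the $n$-th move of $\wp$ comes later than the $k$-th move of its adversary in $\Gamma$, it does so in $\Delta$), then $\Delta$ is won by $\wp$. A game is a function from valuations (assignments of natural numbers to variables) to constant games, and it is static iff all its values are. $\neg$ switches the roles of the two players; $A\wedge B$ and $A\vee B$ are the parallel conjunction and disjunction (both components are played, and $\top$ has to win both, respectively at least one of them); $A\to B$ is $\neg A\vee B$. The (uncountable) branching recurrence $!A$ is played as follows. An actual node of a position is a bit string that is empty or of the form $u0$ or $u1$, where the move "$u{:}$" occurs in the position; a leaf is an actual node that is not a proper prefix of another actual node. The legal moves are the replicative moves "$w{:}$" by $\bot$, for a leaf $w$, and the moves "$w.\alpha$" by either player, for an actual node $w$, such that for every infinite bit string $v$ the move $\alpha$ is legal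 for that player in the position $\Phi^{\preceq wv}$ of $A$. Here $\Phi$ is the current position, and $\Theta^{\preceq x}$ consists of the moves $\beta$ for which $u.\beta$ occurs in $\Theta$ with $u$ an initial segment of $x$. A legal run $\Gamma$ of $!A$ is won by $\top$ iff $\Gamma^{\preceq v}$ is a $\top$-won run of $A$ for every infinite bit string $v$. A hard-play machine (HPM) is a deterministic Turing machine with a work tape, a read-only valuation tape and a read-only run tape spelling the current position; in each step it makes at most one move, while the environment can make any finite number of moves. It wins a game iff on every valuation $e$, whatever the environment does, the generated run is won by $\top$ in the value of the game at $e$. A formula is uniformly valid iff there is one HPM that wins it under every interpretation of its letters by static games. An enumeration game is a constant game in which every natural number (in decimal representation) is a legal move for either player at any time, there are no other legal moves, and the winner of a legal run depends only on the two sets of numbers that the two players have made as moves. **Theorem.** Let $P$ be a letter. The long production formula $$P\wedge\, !(P\to P\wedge P)\,\wedge\, !(P\vee P\to P)\ \to\ !P$$ is not uniformly valid. Moreover, for every HPM $\mathcal H$ and every valuation $e$ there is a static enumeration game $A$ such that, with $P$ interpreted as $A$, some run generated by $\mathcal H$ on $e$ is won by the environment. -/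

import Mathlib

namespace CoL

/-! ### Moves, players, runs -/

/-- The two players: `top` is the machine, `bot` is its environment. -/
inductive Player where
  | top
  | bot
deriving DecidableEq

/-- The adversary of a player. -/
def Player.neg : Player → Player
  | .top => .bot
  | .bot => .top

/-- The (finite) keyboard alphabet: the ten digits, the period, the colon and 83 further symbols
(so 95 symbols, as many as there are printable ASCII characters). -/
inductive Key where
  | digit (d : Fin 10)
  | dot
  | colon
  | other (k : Fin 83)
deriving DecidableEq

/-- A move is a finite string over the keyboard alphabet. -/
abbrev Move := List Key

/-- A labeled move: a move together with the player who makes it. -/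
@[ext] structure LabMove where
  player : Player
  move : Move

/-- The same move made by the other player. -/
def LabMove.neg (m : LabMove) : LabMove := ⟨m.player.neg, m.move⟩

/-- A position is a finite sequence of labeled moves. -/
abbrev Position := List LabMove

/-- A run is a finite or infinite sequence of labeled moves. -/
abbrev Run := Stream'.Seq LabMove

/-- `Φ` is a finite initial segment of the run `Γ`. -/
def Run.HasPrefix (Γ : Run) (Φ : Position) : Prop := Γ.take Φ.length = Φ

open Classical in
/-- The (finite or infinite) run that a growing sequence of positions, each one extending the
preceding ones, converges to. -/
noncomputable def Run.limit (R : ℕ → Position) : Run :=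
  ⟨fun n => if h : ∃ m k, (R k)[n]? = some m then some h.choose else none, by
    intro n hn
    by_cases h : ∃ m k, (R k)[n + 1]? = some m
    · exfalso
      obtain ⟨m, k, hk⟩ := h
      have hlt : n < (R k).length := by
        obtain ⟨hlt, -⟩ := List.getElem?_eq_some_iff.1 hk
        omega
      have h' : ∃ m k, (R k)[n]? = some m := ⟨(R k)[n], k, List.getElem?_eq_getElem hlt⟩
      simp only [dif_pos h'] at hn
      cases hn
    · exact dif_neg h⟩

/-- Apply a partial map to every labeled move of a run, deleting those where it is undefined. -/
noncomputable def Run.filterMap (f : LabMove → Option LabMove) (Γ : Run) : Run :=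
  Run.limit fun k => (Γ.take k).filterMap f

/-! ### Constant games -/

/-- A constant game. The set of legal runs is given by the set of legal positions: a run is
legal iff all of its finite initial segments are. A run that some player made illegal is lost
by that player. -/
structure ConstGame where
  /-- the legal positions -/
  Legal : Position → Prop
  legal_nil : Legal []
  legal_of_append : ∀ Φ Ψ, Legal (Φ ++ Ψ) → Legal Φ
  /-- the winner of a run -/
  Wn : Run → Player
  wn_of_illegal : ∀ (Γ : Run) (Φ : Position) (m : LabMove),
    Γ.HasPrefix (Φ ++ [m]) → Legal Φ → ¬ Legal (Φ ++ [m]) → Wn Γ = m.player.neg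

/-- A run is legal iff all its finite initial segments are legal positions. -/
def ConstGame.LegalRun (A : ConstGame) (Γ : Run) : Prop := ∀ k, A.Legal (Γ.take k)

/-- With `Legal` for the legal positions, the first illegal move of `Γ` is made by `p`. -/
def IllegalBy (Legal : Position → Prop) (p : Player) (Γ : Run) : Prop :=
  ∃ (Φ : Position) (α : Move),
    Γ.HasPrefix (Φ ++ [⟨p, α⟩]) ∧ Legal Φ ∧ ¬ Legal (Φ ++ [⟨p, α⟩])

theorem Run.HasPrefix.take_eq {Γ : Run} {Φ Ψ : Position} (hΦ : Γ.HasPrefix Φ)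
    (hΨ : Γ.HasPrefix Ψ) (h : Φ.length ≤ Ψ.length) : Ψ.take Φ.length = Φ := by
  unfold Run.HasPrefix at hΦ hΨ
  conv_rhs => rw [← hΦ]
  rw [← hΨ]
  apply List.ext_getElem?
  intro k
  rw [List.getElem?_take, Stream'.Seq.getElem?_take, Stream'.Seq.getElem?_take]
  by_cases hk : k < Φ.length
  · rw [if_pos hk, if_pos hk, if_pos (hk.trans_le h)]
  · rw [if_neg hk, if_neg hk]

theorem eq_of_illegal {Legal : Position → Prop}
    (happ : ∀ Φ Ψ, Legal (Φ ++ Ψ) → Legal Φ) {Γ : Run} {Φ Ψ : Position} {m n : LabMove}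
    (h₁ : Γ.HasPrefix (Φ ++ [m])) (h₂ : Legal Φ) (h₃ : ¬ Legal (Φ ++ [m]))
    (k₁ : Γ.HasPrefix (Ψ ++ [n])) (k₂ : Legal Ψ) (k₃ : ¬ Legal (Ψ ++ [n])) : m = n := by
  have key : ∀ {Φ Ψ : Position} {m n : LabMove}, Γ.HasPrefix (Φ ++ [m]) → ¬ Legal (Φ ++ [m]) →
      Γ.HasPrefix (Ψ ++ [n]) → Legal Ψ → ¬ Φ.length < Ψ.length := by
    intro Φ Ψ m n h₁ h₃ k₁ k₂ hlt
    have h := h₁.take_eq k₁ (by simp; omega)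
    rw [List.take_append_of_le_length (by simp; omega)] at h
    apply h₃
    rw [← h]
    apply happ _ (Ψ.drop (Φ ++ [m]).length)
    rwa [List.take_append_drop]
  have hl : Φ.length = Ψ.length := by
    have := key h₁ h₃ k₁ k₂
    have := key k₁ k₃ h₁ h₂
    omega
  have h := h₁.take_eq k₁ (by simp [hl])
  rw [List.take_of_length_le (by simp [hl])] at h
  have := (List.append_inj' h rfl).2
  simpa using this.symm

open Classical in
/-- The game with given legal positions, in which a legal run `Γ` is won by `out Γ` and an illegal
run is lost by the player who made the first illegal move. -/
noncomputable def ConstGame.ofLegal (Legal : Position → Prop) (hnil : Legal [])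
    (happ : ∀ Φ Ψ, Legal (Φ ++ Ψ) → Legal Φ) (out : Run → Player) : ConstGame where
  Legal := Legal
  legal_nil := hnil
  legal_of_append := happ
  Wn Γ :=
    if IllegalBy Legal .top Γ then .bot else if IllegalBy Legal .bot Γ then .top else out Γ
  wn_of_illegal := by
    rintro Γ Φ ⟨p, α⟩ h₁ h₂ h₃
    cases p
    · rw [if_pos ⟨Φ, α, h₁, h₂, h₃⟩]
      rfl
    · rw [if_neg, if_pos ⟨Φ, α, h₁, h₂, h₃⟩]
      · rfl
      · rintro ⟨Ψ, β, k₁, k₂, k₃⟩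
        have := eq_of_illegal happ h₁ h₂ h₃ k₁ k₂ k₃
        cases this

/-! ### Static games -/

/-- The subsequence of the moves of the run `Γ` made by `p`. -/
noncomputable def Run.movesOf (p : Player) (Γ : Run) : Run :=
  Γ.filterMap fun m => if m.player = p then some m else none

/-- The `n`-th move (counting from 0) of the player `p` in `Γ` is the `i`-th labeled move
of `Γ`. -/
def Run.IsNthMoveOf (Γ : Run) (p : Player) (n i : ℕ) : Prop :=
  (∃ α, Γ.get? i = some ⟨p, α⟩) ∧ (Γ.take i).countP (fun m => m.player = p) = n

/-- `Δ` is a `p`-delay of `Γ`: each player makes the same moves in the same order in both runs,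
and if the `n`-th move of `p` comes later than the `k`-th move of its adversary in `Γ`,
then so it does in `Δ`. -/
def IsDelay (p : Player) (Γ Δ : Run) : Prop :=
  (∀ q, Γ.movesOf q = Δ.movesOf q) ∧
  ∀ n k i j, Γ.IsNthMoveOf p n i → Γ.IsNthMoveOf p.neg k j → j < i →
    ∀ i' j', Δ.IsNthMoveOf p n i' → Δ.IsNthMoveOf p.neg k j' → j' < i'

/-- A static game: delaying its own moves never turns a win of a player into a loss. -/
def ConstGame.Static (A : ConstGame) : Prop :=
  ∀ (p : Player) (Γ Δ : Run), IsDelay p Γ Δ → A.Wn Γ = p → A.Wn Δ = p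

/-! ### Game operations -/

/-- Negation: the two players switch roles. -/
noncomputable def ConstGame.neg (A : ConstGame) : ConstGame :=
  .ofLegal (fun Φ => A.Legal (Φ.map LabMove.neg)) A.legal_nil
    (fun Φ Ψ h => A.legal_of_append _ (Ψ.map LabMove.neg) (by simpa using h))
    (fun Γ => (A.Wn (Γ.map LabMove.neg)).neg)

/-- Delete the prefix `pre` from a labeled move; undefined if the move does not start with it. -/
def LabMove.strip (pre : Move) (m : LabMove) : Option LabMove :=
  if pre <+: m.move then some ⟨m.player, m.move.drop pre.length⟩ else none

/-- The prefix `0.` of the moves in the left component of a parallel combination. -/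
def leftTag : Move := [.digit 0, .dot]

/-- The prefix `1.` of the moves in the right component of a parallel combination. -/
def rightTag : Move := [.digit 1, .dot]

/-- Legal positions of both parallel conjunction and parallel disjunction. -/
def ParLegal (A B : ConstGame) (Φ : Position) : Prop :=
  (∀ m ∈ Φ, leftTag <+: m.move ∨ rightTag <+: m.move) ∧
    A.Legal (Φ.filterMap (LabMove.strip leftTag)) ∧
    B.Legal (Φ.filterMap (LabMove.strip rightTag))

theorem parLegal_nil (A B : ConstGame) : ParLegal A B [] :=
  ⟨by simp, A.legal_nil, B.legal_nil⟩

theorem parLegal_of_append (A B : ConstGame) (Φ Ψ : Position) (h : ParLegal A B (Φ ++ Ψ)) :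
    ParLegal A B Φ := by
  obtain ⟨h₁, h₂, h₃⟩ := h
  rw [List.filterMap_append] at h₂ h₃
  exact ⟨fun m hm => h₁ m (List.mem_append_left _ hm), A.legal_of_append _ _ h₂,
    B.legal_of_append _ _ h₃⟩

open Classical in
/-- Parallel conjunction: both games are played, and the machine has to win both. -/
noncomputable def ConstGame.conj (A B : ConstGame) : ConstGame :=
  .ofLegal (ParLegal A B) (parLegal_nil A B) (parLegal_of_append A B) fun Γ =>
    if A.Wn (Γ.filterMap (LabMove.strip leftTag)) = .top ∧
      B.Wn (Γ.filterMap (LabMove.strip rightTag)) = .top then .top else .bot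

open Classical in
/-- Parallel disjunction: both games are played, and the machine has to win one of them. -/
noncomputable def ConstGame.disj (A B : ConstGame) : ConstGame :=
  .ofLegal (ParLegal A B) (parLegal_nil A B) (parLegal_of_append A B) fun Γ =>
    if A.Wn (Γ.filterMap (LabMove.strip leftTag)) = .top ∨
      B.Wn (Γ.filterMap (LabMove.strip rightTag)) = .top then .top else .bot

/-- A finite bit string as a string over the keyboard alphabet. -/
def bits (w : List Bool) : Move := w.map fun b => .digit (if b then 1 else 0)

/-- The bit string `w` is an actual node of the position `Φ` of a branching recurrence: it is
empty, or else `u0` or `u1` for some `u` such that `Φ` contains the replicative move `u:`. -/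
def IsActualNode (Φ : Position) (w : List Bool) : Prop :=
  w = [] ∨ ∃ (u : List Bool) (b : Bool), w = u ++ [b] ∧ ∃ m ∈ Φ, m.move = bits u ++ [.colon]

/-- A leaf is an actual node that is not a proper prefix of any other actual node. -/
def IsLeaf (Φ : Position) (w : List Bool) : Prop :=
  IsActualNode Φ w ∧ ∀ w', IsActualNode Φ w' → w <+: w' → w' = w

open Classical in
/-- For an infinite bit string `x`: turn a move `u.β`, where `u` is an initial segment of `x`,
into `β`; undefined on all other moves. -/
noncomputable def LabMove.stripThread (x : Stream' Bool) (m : LabMove) : Option LabMove :=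
  if ∃ n : ℕ, bits (x.take n) ++ [.dot] <+: m.move then
    some ⟨m.player, (m.move.dropWhile (fun c => c ≠ .dot)).drop 1⟩
  else none

/-- The labeled move `m` is legal in position `Φ` of the branching recurrence of `A`: it is
either a replicative move `w:` of the environment, with `w` a leaf, or a non-replicative move `w.α`
of either player, with `w` an actual node and `α` legal for that player in all threads
through `w`. -/
def BrecLegalMove (A : ConstGame) (Φ : Position) (m : LabMove) : Prop :=
  (m.player = .bot ∧ ∃ w, IsLeaf Φ w ∧ m.move = bits w ++ [.colon]) ∨
  ∃ (w : List Bool) (α : Move), IsActualNode Φ w ∧ m.move = bits w ++ .dot :: α ∧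
    ∀ v : Stream' Bool,
      A.Legal (Φ.filterMap (LabMove.stripThread (w ++ₛ v)) ++ [⟨m.player, α⟩])

open Classical in
/-- (Uncountable) branching recurrence: the environment may split any thread at any time, and the
machine has to win `A` in the thread of every infinite bit string. -/
noncomputable def ConstGame.brec (A : ConstGame) : ConstGame :=
  .ofLegal (fun Φ => ∀ (Ψ : Position) (m : LabMove), Ψ ++ [m] <+: Φ → BrecLegalMove A Ψ m)
    (by
      intro Ψ m h
      simp at h)
    (fun Φ Φ' h Ψ m hΨ => h Ψ m (hΨ.trans (List.prefix_append _ _)))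
    fun Γ =>
      if ∀ v : Stream' Bool, A.Wn (Γ.filterMap (LabMove.stripThread v)) = .top
      then .top else .bot

/-! ### Games, formulas, interpretations -/

/-- A valuation assigns a constant (a natural number) to each of the variables
`v₀, v₁, v₂, …`. -/
abbrev Valuation := ℕ → ℕ

/-- A (not necessarily constant) game: a function from valuations to constant games. -/
abbrev Game := Valuation → ConstGame

/-- A game is static iff all its instances are. -/
def Game.Static (A : Game) : Prop := ∀ e, (A e).Static

/-- Formulas built from 0-ary general letters by negation, parallel conjunction, parallel
disjunction and branching recurrence. -/
inductive Formula where
  | letter (n : ℕ)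
  | neg (F : Formula)
  | conj (F G : Formula)
  | disj (F G : Formula)
  | brec (F : Formula)

/-- Implication `F → G` abbreviates `¬F ∨ G`. -/
def Formula.imp (F G : Formula) : Formula := .disj (.neg F) G

/-- The game into which a formula turns when the letters are interpreted by games. -/
noncomputable def Formula.interp (I : ℕ → Game) : Formula → Game
  | .letter n => I n
  | .neg F => fun e => (F.interp I e).neg
  | .conj F G => fun e => (F.interp I e).conj (G.interp I e)
  | .disj F G => fun e => (F.interp I e).disj (G.interp I e)
  | .brec F => fun e => (F.interp I e).brec

/-- An interpretation sends each letter to a static game. -/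
structure Interpretation where
  game : ℕ → Game
  static : ∀ n, (game n).Static

/-- Long production: `P ∧ !(P → P ∧ P) ∧ !(P ∨ P → P) → !P`, with branching recurrence as `!`. -/
def Formula.longProduction (P : Formula) : Formula :=
  .imp (.conj (.conj P (.brec (.imp P (.conj P P)))) (.brec (.imp (.disj P P) P))) (.brec P)

/-! ### Hard-play machines -/

/-- The decimal representation of a natural number. -/
def decimal (n : ℕ) : Move :=
  if n = 0 then [.digit 0] else (Nat.digits 10 n).reverse.map fun d => .digit (Fin.ofNat 10 d)

/-- Directions in which a head may move. -/
inductive Dir where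
  | left
  | stay
  | right

/-- New head position; at the leftmost cell of a tape a head does not move to the left. -/
def Dir.apply : Dir → ℕ → ℕ
  | .left, i => i - 1
  | .stay, i => i
  | .right, i => i + 1

/-- Symbols on the run tape: the labels of the two players and the keyboard symbols. -/
inductive RunSym where
  | label (p : Player)
  | key (k : Key)

/-- The content of the run tape (`none` is the blank): the current position spelled out. -/
def runTape (Φ : Position) (i : ℕ) : Option RunSym :=
  (Φ.flatMap fun m => .label m.player :: m.move.map .key)[i]?

/-- The content of the valuation tape: the constants `e 0, e 1, e 2, …` in decimal notation, each
followed by a separator (`none`). -/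
def valuationTape (e : Valuation) (i : ℕ) : Option Key :=
  ((List.range (i + 1)).flatMap fun j => (decimal (e j)).map some ++ [none]).getD i none

/-- A hard-play machine: a deterministic Turing machine with a read/write work tape, a read-only
valuation tape and a read-only run tape, some of whose finitely many states are move states. The
work tape alphabet has the keyboard symbols, finitely many auxiliary symbols, and the blank
(`none`). From the state and the three scanned symbols, `step` determines the next state,
the symbol to write on the work tape, and how the work, valuation and run heads move. -/
structure HPM where
  State : Type
  finite_state : Finite State
  start : State
  moveStates : Set State
  Aux : Type
  finite_aux : Finite Aux
  step : State → Option (Key ⊕ Aux) → Option Key → Option RunSym →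
    State × Option (Key ⊕ Aux) × Dir × Dir × Dir

/-- A configuration of a hard-play machine. The run tape is represented by the position that it
spells. -/
structure HPM.Config (H : HPM) where
  state : H.State
  work : ℕ → Option (Key ⊕ H.Aux)
  workHead : ℕ
  valuationHead : ℕ
  runHead : ℕ
  position : Position

/-- The initial configuration: start state, blank work and run tapes, heads at the left ends. -/
def HPM.init (H : HPM) : H.Config := ⟨H.start, fun _ => none, 0, 0, 0, []⟩

/-- The move spelled on the work tape to the left of the scanned cell. -/
def HPM.Config.output {H : HPM} (C : H.Config) : Move :=
  (List.range C.workHead).filterMap fun i =>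
    match C.work i with
    | some (.inl k) => some k
    | _ => none

open Classical in
/-- The labeled move (if any) that the machine makes in a configuration. -/
noncomputable def HPM.Config.machineMove {H : HPM} (C : H.Config) : Position :=
  if C.state ∈ H.moveStates then [⟨.top, C.output⟩] else []

/-- The next configuration, if `Ψ` is the finite sequence of moves that the environment makes
during this step. The machine makes at most one move. -/
noncomputable def HPM.next (H : HPM) (e : Valuation) (C : H.Config) (Ψ : List Move) : H.Config :=
  let a := H.step C.state (C.work C.workHead) (valuationTape e C.valuationHead)
    (runTape C.position C.runHead)
  { state := a.1
    work := Function.update C.work C.workHead a.2.1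
    workHead := a.2.2.1.apply C.workHead
    valuationHead := a.2.2.2.1.apply C.valuationHead
    runHead := a.2.2.2.2.apply C.runHead
    position := C.position ++ C.machineMove ++ Ψ.map fun α => ⟨.bot, α⟩ }

/-- `C` is a computation branch of `H` on valuation `e`, for some behavior of the environment. -/
def HPM.IsBranch (H : HPM) (e : Valuation) (C : ℕ → H.Config) : Prop :=
  C 0 = H.init ∧ ∀ i, ∃ Ψ : List Move, C (i + 1) = H.next e (C i) Ψ

/-- `Γ` is a run generated by `H` on valuation `e`: the run spelled by a computation branch. -/
def HPM.Generates (H : HPM) (e : Valuation) (Γ : Run) : Prop :=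
  ∃ C : ℕ → H.Config, H.IsBranch e C ∧ Γ = Run.limit fun i => (C i).position

/-- `H` wins the game `A`: whatever the valuation and the behavior of the environment are, the
generated run is won by the machine. -/
def HPM.Wins (H : HPM) (A : Game) : Prop :=
  ∀ (e : Valuation) (Γ : Run), H.Generates e Γ → (A e).Wn Γ = .top

/-- Uniform validity: a single machine wins the formula under every interpretation. -/
def UniformlyValid (F : Formula) : Prop :=
  ∃ H : HPM, ∀ I : Interpretation, H.Wins (F.interp I.game)

/-! ### Enumeration games -/

/-- The set of the numbers enumerated by the player `p` in the run `Γ`. -/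
def Run.enumerated (Γ : Run) (p : Player) : Set ℕ :=
  {n | ∃ i, Γ.get? i = some ⟨p, decimal n⟩}

/-- An enumeration game: the legal moves of either player at any time are exactly the natural
numbers in decimal representation, and the winner of a legal run depends only on the two sets
of numbers enumerated by the two players. -/
def ConstGame.IsEnumeration (A : ConstGame) : Prop :=
  (∀ Φ : Position, A.Legal Φ ↔ ∀ m ∈ Φ, ∃ n, m.move = decimal n) ∧
  ∀ Γ Δ : Run, A.LegalRun Γ → A.LegalRun Δ →
    (∀ p, Γ.enumerated p = Δ.enumerated p) → A.Wn Γ = A.Wn Δ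

end CoL

/-!
In both recurrences of the antecedent and in that of the succedent, let the environment mark every
actual node `w` by enumerating a number that encodes `w` in the input copy of `A` at `w`, and let it
split all threads of the succedent. The pair of sets enumerated in a marked copy of `A` then
determines the thread up to moves that were never made, hence the play in that thread. So a thread
of the antecedent that turns a value of its input copy into a value of an output copy induces a
partial function on values for each output, and the values that can be reached in this way from the
value of the first conjunct form a countable set `T`. On the other hand, the continuum many threads
of the succedent have pairwise different values, one of which is therefore not in `T`. If `A` is the
enumeration game that `⊤` wins iff the value is in `T`, the environment wins the antecedent and the
machine loses the succedent. The moves and their legality do not depend on `T`, which can thus be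
chosen after the run.
-/

namespace CoL

open Filter

/-! ### Runs and their initial segments -/

section Sequences

variable {α : Type*} {s : Stream'.Seq α} {a : α} {i j k : ℕ}

theorem mem_seq_iff_get? : a ∈ s ↔ ∃ i, s.get? i = some a := by
  simp only [Stream'.Seq.mem_iff_exists_get?, eq_comm]

theorem mem_seq_take : a ∈ s.take k ↔ ∃ i < k, s.get? i = some a := by
  simp only [List.mem_iff_getElem?, Stream'.Seq.getElem?_take, Option.ite_none_right_eq_some]

theorem mem_seq_iff_mem_take : a ∈ s ↔ ∃ k, a ∈ s.take k := by
  simp only [mem_seq_iff_get?, mem_seq_take]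
  exact ⟨fun ⟨i, hi⟩ => ⟨i + 1, i, i.lt_succ_self, hi⟩, fun ⟨_, i, _, hi⟩ => ⟨i, hi⟩⟩

theorem take_seq_take (h : i ≤ j) : (s.take j).take i = s.take i := by
  ext1 k
  simp only [List.getElem?_take, Stream'.Seq.getElem?_take]
  grind

theorem seq_take_prefix_take (h : i ≤ j) : s.take i <+: s.take j :=
  take_seq_take (s := s) h ▸ List.take_prefix _ _

theorem eventually_mem_seq_take (h : a ∈ s) : ∀ᶠ k in atTop, a ∈ s.take k := by
  obtain ⟨k, hk⟩ := mem_seq_iff_mem_take.1 h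
  filter_upwards [eventually_ge_atTop k] with j hj using (seq_take_prefix_take hj).subset hk

theorem seq_take_succ (h : s.get? i = some a) : s.take (i + 1) = s.take i ++ [a] := by
  induction i generalizing s with
  | zero => cases s using Stream'.Seq.recOn <;> simp_all
  | succ i ih => cases s using Stream'.Seq.recOn <;> simp_all

theorem seq_take_map {β : Type*} (g : α → β) : (s.map g).take k = (s.take k).map g := by
  ext1 i
  simp only [Stream'.Seq.getElem?_take, List.getElem?_map, Stream'.Seq.map_get?]
  split_ifs <;> rfl

end Sequences

theorem Run.hasPrefix_iff {Γ : Run} {Φ : Position} :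
    Γ.HasPrefix Φ ↔ ∀ i (hi : i < Φ.length), Γ.get? i = some Φ[i] := by
  constructor
  · intro h i hi
    rw [← List.getElem?_eq_getElem hi]
    conv_rhs => rw [← h]
    rw [Stream'.Seq.getElem?_take, if_pos hi]
  · intro h
    ext1 i
    rw [Stream'.Seq.getElem?_take]
    split_ifs with hi
    · rw [h i hi, List.getElem?_eq_getElem hi]
    · rw [List.getElem?_eq_none (not_lt.1 hi)]

theorem Run.hasPrefix_take (Γ : Run) (k : ℕ) : Γ.HasPrefix (Γ.take k) :=
  Run.hasPrefix_iff.2 fun i hi => by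
    have h := List.getElem?_eq_getElem hi
    rw [Stream'.Seq.getElem?_take] at h
    exact (Option.ite_none_right_eq_some.1 h).2

theorem Run.HasPrefix.of_prefix {Γ : Run} {Φ Ψ : Position} (h : Γ.HasPrefix Φ)
    (hΨ : Ψ <+: Φ) : Γ.HasPrefix Ψ :=
  Run.hasPrefix_iff.2 fun i hi => by
    rw [Run.hasPrefix_iff.1 h i (hi.trans_le hΨ.length_le), hΨ.getElem hi]

theorem Run.HasPrefix.prefix_of_length_le {Γ : Run} {Φ Ψ : Position} (hΦ : Γ.HasPrefix Φ)
    (hΨ : Γ.HasPrefix Ψ) (h : Φ.length ≤ Ψ.length) : Φ <+: Ψ :=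
  hΦ.take_eq hΨ h ▸ List.take_prefix _ _

theorem Run.HasPrefix.exists_take_eq {Γ : Run} {Φ : Position} {k : ℕ} (h : Γ.HasPrefix Φ)
    (hk : Γ.take k <+: Φ) : ∃ j ≥ k, Γ.take j = Φ := by
  rcases le_total k Φ.length with hle | hle
  · exact ⟨_, hle, h⟩
  · have hΦ : Φ <+: Γ.take k := by
      conv_lhs => rw [← h]
      exact seq_take_prefix_take hle
    exact ⟨k, le_rfl, hk.eq_of_length_le hΦ.length_le⟩

/-! ### Limits of growing positions -/

/-- A sequence of positions each of which extends the preceding ones, so that it has a limit run. -/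
def IsGrowing (R : ℕ → Position) : Prop := ∀ ⦃i j⦄, i ≤ j → R i <+: R j

theorem isGrowing_of_succ {R : ℕ → Position} (h : ∀ i, R i <+: R (i + 1)) : IsGrowing R := by
  intro i j hij
  induction hij with
  | refl => exact List.prefix_rfl
  | step _ ih => exact ih.trans (h _)

theorem isGrowing_filterMap_take (f : LabMove → Option LabMove) (Γ : Run) :
    IsGrowing fun k => (Γ.take k).filterMap f :=
  fun _ _ hij => (seq_take_prefix_take hij).filterMap f

namespace IsGrowing

variable {R : ℕ → Position} (hR : IsGrowing R)
include hR

theorem getElem?_unique {n k k' : ℕ} {m m' : LabMove} (h : (R k)[n]? = some m)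
    (h' : (R k')[n]? = some m') : m = m' := by
  have hmax : ∀ {i m}, i ≤ max k k' → (R i)[n]? = some m → (R (max k k'))[n]? = some m := by
    intro i m hi hm
    obtain ⟨hn, rfl⟩ := List.getElem?_eq_some_iff.1 hm
    exact List.prefix_iff_getElem?.1 (hR hi) n hn
  exact Option.some_injective _
    ((hmax (le_max_left k k') h).symm.trans (hmax (le_max_right k k') h'))

theorem get?_limit {n : ℕ} {m : LabMove} :
    (Run.limit R).get? n = some m ↔ ∃ k, (R k)[n]? = some m := by
  classical
  have hdef : (Run.limit R).get? n =
      if h : ∃ m k, (R k)[n]? = some m then some h.choose else none := rfl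
  rw [hdef]
  constructor
  · intro h
    split_ifs at h with hex
    exact Option.some_injective _ h ▸ hex.choose_spec
  · intro hk
    have hex : ∃ m k, (R k)[n]? = some m := ⟨m, hk⟩
    rw [dif_pos hex, hR.getElem?_unique hex.choose_spec.choose_spec hk.choose_spec]

theorem hasPrefix_limit (j : ℕ) : (Run.limit R).HasPrefix (R j) :=
  Run.hasPrefix_iff.2 fun _ hi => hR.get?_limit.2 ⟨j, List.getElem?_eq_getElem hi⟩

theorem exists_prefix_of_hasPrefix_limit {Φ : Position} (h : (Run.limit R).HasPrefix Φ) :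
    ∃ j, Φ <+: R j := by
  rcases Φ.eq_nil_or_concat' with rfl | ⟨Φ, m, rfl⟩
  · exact ⟨0, List.nil_prefix⟩
  · have hm : (Run.limit R).get? Φ.length = some m := by
      rw [Run.hasPrefix_iff.1 h Φ.length (by simp), List.getElem_concat_length rfl]
    obtain ⟨j, hj⟩ := hR.get?_limit.1 hm
    obtain ⟨hlt, -⟩ := List.getElem?_eq_some_iff.1 hj
    exact ⟨j, h.prefix_of_length_le (hR.hasPrefix_limit j) (by simpa using hlt)⟩

theorem mem_limit {m : LabMove} : m ∈ Run.limit R ↔ ∃ k, m ∈ R k := by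
  simp only [mem_seq_iff_get?, hR.get?_limit, List.mem_iff_getElem?]
  exact exists_comm

end IsGrowing

theorem Run.mem_filterMap {f : LabMove → Option LabMove} {Γ : Run} {m : LabMove} :
    m ∈ Γ.filterMap f ↔ ∃ m' ∈ Γ, f m' = some m := by
  rw [Run.filterMap, (isGrowing_filterMap_take f Γ).mem_limit]
  simp only [List.mem_filterMap, mem_seq_iff_mem_take (s := Γ)]
  grind

theorem Run.take_filterMap_prefix (f : LabMove → Option LabMove) (Γ : Run) (k : ℕ) :
    ∃ j, (Γ.filterMap f).take k <+: (Γ.take j).filterMap f :=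
  (isGrowing_filterMap_take f Γ).exists_prefix_of_hasPrefix_limit (Run.hasPrefix_take _ k)

theorem Run.filterMap_congr {f g : LabMove → Option LabMove} {Γ : Run}
    (h : ∀ m ∈ Γ, f m = g m) : Γ.filterMap f = Γ.filterMap g := by
  unfold Run.filterMap
  congr 1
  funext k
  exact List.filterMap_congr fun m hm => h m (mem_seq_iff_mem_take.2 ⟨k, hm⟩)

/-! ### Moves and their prefixes -/

theorem Player.neg_neg (p : Player) : p.neg.neg = p := by cases p <;> rfl

theorem Player.ne_iff_eq_neg {p q : Player} : p ≠ q ↔ p = q.neg := by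
  cases p <;> cases q <;> simp [Player.neg]

theorem Player.neg_eq_iff {p q : Player} : p.neg = q ↔ p = q.neg := by
  cases p <;> cases q <;> simp [Player.neg]

theorem LabMove.neg_neg (m : LabMove) : m.neg.neg = m := by
  simp only [LabMove.neg, Player.neg_neg]

theorem LabMove.neg_eq_iff {m m' : LabMove} : m.neg = m' ↔ m = m'.neg :=
  ⟨fun h => by rw [← h, LabMove.neg_neg], fun h => by rw [h, LabMove.neg_neg]⟩

theorem LabMove.strip_eq_some {pre : Move} {m m' : LabMove} :
    m.strip pre = some m' ↔ m = ⟨m'.player, pre ++ m'.move⟩ := by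
  constructor
  · intro h
    obtain ⟨hpre, h⟩ := Option.ite_none_right_eq_some.1 h
    obtain rfl := Option.some_injective _ h
    ext1
    · rfl
    · exact (List.prefix_append_drop hpre).trans rfl
  · rintro rfl
    simp [LabMove.strip]

/-- The prefix of the moves in the left (`false`) or right (`true`) component of a parallel
combination. -/
def tag : Bool → Move
  | false => leftTag
  | true => rightTag

theorem tag_append_inj {b c : Bool} {α β : Move} : tag b ++ α = tag c ++ β ↔ b = c ∧ α = β := by
  cases b <;> cases c <;> simp [tag, leftTag, rightTag]

theorem strip_tag (b c : Bool) (p : Player) (α : Move) :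
    (⟨p, tag b ++ α⟩ : LabMove).strip (tag c) = if b = c then some ⟨p, α⟩ else none := by
  ext m
  rw [LabMove.strip_eq_some, LabMove.mk.injEq, tag_append_inj, Option.ite_none_right_eq_some,
    Option.some_inj, LabMove.ext_iff]
  tauto

theorem bits_injective : Function.Injective bits :=
  List.map_injective_iff.2 fun b c h => by cases b <;> cases c <;> simp_all

theorem dot_notMem_bits (w : List Bool) : Key.dot ∉ bits w := by simp [bits]

theorem drop_dropWhile_bits_append (w : List Bool) (α : Move) :
    ((bits w ++ .dot :: α).dropWhile (fun c => c ≠ .dot)).drop 1 = α := by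
  rw [List.dropWhile_append_of_pos fun c hc => by
    simpa using ne_of_mem_of_not_mem hc (dot_notMem_bits w)]
  simp

theorem bits_append_dot_inj {u w : List Bool} {α β : Move} :
    bits u ++ .dot :: α = bits w ++ .dot :: β ↔ u = w ∧ α = β := by
  refine ⟨fun h => ?_, fun ⟨h, h'⟩ => by rw [h, h']⟩
  obtain rfl : α = β := by
    rw [← drop_dropWhile_bits_append u α, h, drop_dropWhile_bits_append]
  exact ⟨bits_injective (List.append_left_inj _ |>.1 h), rfl⟩

theorem bits_append_colon_inj {u w : List Bool} :
    bits u ++ [Key.colon] = bits w ++ [.colon] ↔ u = w := by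
  rw [List.append_left_inj, bits_injective.eq_iff]

theorem bits_append_dot_ne_colon {u w : List Bool} {α : Move} :
    bits u ++ .dot :: α ≠ bits w ++ [.colon] := by
  intro h
  have hdot : Key.dot ∈ bits w ++ [Key.colon] := by simp [← h]
  simp [dot_notMem_bits] at hdot

theorem LabMove.stripThread_eq_some {x : Stream' Bool} {m m' : LabMove} :
    m.stripThread x = some m' ↔
      ∃ n : ℕ, m = ⟨m'.player, bits (x.take n) ++ .dot :: m'.move⟩ := by
  constructor
  · intro h
    obtain ⟨⟨n, α, hα⟩, h⟩ := Option.ite_none_right_eq_some.1 h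
    rw [List.append_assoc, List.singleton_append] at hα
    obtain rfl := Option.some_injective _ h
    refine ⟨n, ?_⟩
    ext1
    · rfl
    · simp only [← hα, drop_dropWhile_bits_append]
  · rintro ⟨n, rfl⟩
    rw [LabMove.stripThread, if_pos ⟨n, m'.move, List.append_assoc _ _ _⟩,
      drop_dropWhile_bits_append]

theorem stripThread_dot (x : Stream' Bool) (w : List Bool) (p : Player) (α : Move) :
    (⟨p, bits w ++ .dot :: α⟩ : LabMove).stripThread x =
      if x.take w.length = w then some ⟨p, α⟩ else none := by
  ext m
  rw [LabMove.stripThread_eq_some, Option.ite_none_right_eq_some, Option.some_inj,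
    LabMove.ext_iff]
  simp only [LabMove.mk.injEq, bits_append_dot_inj]
  constructor
  · rintro ⟨n, hp, rfl, hα⟩
    exact ⟨by rw [Stream'.length_take], hp, hα⟩
  · rintro ⟨hw, hp, hα⟩
    exact ⟨w.length, hp, hw.symm, hα⟩

theorem stripThread_colon (x : Stream' Bool) (w : List Bool) (p : Player) :
    (⟨p, bits w ++ [.colon]⟩ : LabMove).stripThread x = none := by
  rw [Option.eq_none_iff_forall_ne_some]
  intro m hm
  obtain ⟨n, hn⟩ := LabMove.stripThread_eq_some.1 hm
  exact bits_append_dot_ne_colon (LabMove.mk.inj hn).2.symm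

/-- The value of a key as a decimal digit; keys that are not digits count as zero. -/
def Key.value : Key → ℕ
  | .digit d => d
  | _ => 0

theorem leftInverse_decimal : Function.LeftInverse
    (fun α : Move => Nat.ofDigits 10 (α.reverse.map Key.value)) decimal := by
  intro n
  rcases eq_or_ne n 0 with rfl | hn
  · simp [decimal, Key.value]
  · have hdigits : (Nat.digits 10 n).map (Key.value ∘ fun d => .digit (Fin.ofNat 10 d)) =
        Nat.digits 10 n :=
      (List.map_congr_left (g := id) fun d hd =>
        Nat.mod_eq_of_lt (Nat.digits_lt_base (by norm_num) hd)).trans (List.map_id _)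
    simp only [decimal, if_neg hn, ← List.map_reverse, List.reverse_reverse, List.map_map, hdigits,
      Nat.ofDigits_digits]

theorem decimal_injective : Function.Injective decimal := leftInverse_decimal.injective

/-! ### Components of runs and positions -/

/-- The run with the roles of the players switched. -/
noncomputable def Run.neg (Γ : Run) : Run := Γ.map LabMove.neg

/-- The play in one of the components of a parallel combination. -/
noncomputable def Run.part (b : Bool) (Γ : Run) : Run := Γ.filterMap (LabMove.strip (tag b))

/-- The play in the left component of a parallel combination. -/
noncomputable abbrev Run.left (Γ : Run) : Run := Γ.part false

/-- The play in the right component of a parallel combination. -/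
noncomputable abbrev Run.right (Γ : Run) : Run := Γ.part true

/-- The play in the thread `x` of a branching recurrence. -/
noncomputable def Run.thread (x : Stream' Bool) (Γ : Run) : Run :=
  Γ.filterMap (LabMove.stripThread x)

/-- The position with the roles of the players switched. -/
def Position.neg (Φ : Position) : Position := Φ.map LabMove.neg

/-- The position in one of the components of a parallel combination. -/
def Position.part (b : Bool) (Φ : Position) : Position := Φ.filterMap (LabMove.strip (tag b))

section Membership

variable {Γ : Run} {Φ : Position} {m : LabMove} {b : Bool} {x : Stream' Bool}

theorem Run.mem_neg : m ∈ Γ.neg ↔ m.neg ∈ Γ := by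
  simp only [Run.neg, mem_seq_iff_get?, Stream'.Seq.map_get?, Option.map_eq_some_iff,
    LabMove.neg_eq_iff, exists_eq_right]

theorem Run.mem_part : m ∈ Γ.part b ↔ (⟨m.player, tag b ++ m.move⟩ : LabMove) ∈ Γ := by
  simp only [Run.part, Run.mem_filterMap, LabMove.strip_eq_some, exists_eq_right]

theorem Run.mem_thread :
    m ∈ Γ.thread x ↔ ∃ n, (⟨m.player, bits (x.take n) ++ .dot :: m.move⟩ : LabMove) ∈ Γ := by
  simp only [Run.thread, Run.mem_filterMap, LabMove.stripThread_eq_some]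
  grind

theorem Position.mem_neg : m ∈ Φ.neg ↔ m.neg ∈ Φ := by
  simp only [Position.neg, List.mem_map, LabMove.neg_eq_iff, exists_eq_right]

theorem Position.mem_part : m ∈ Φ.part b ↔ (⟨m.player, tag b ++ m.move⟩ : LabMove) ∈ Φ := by
  simp only [Position.part, List.mem_filterMap, LabMove.strip_eq_some, exists_eq_right]

end Membership


/-! ### Winners and legal runs -/

theorem ite_top_eq_top {c : Prop} [Decidable c] :
    (if c then Player.top else Player.bot) = .top ↔ c := by
  split_ifs with h <;> simp [h]

namespace ConstGame

variable {A B : ConstGame} {Γ : Run} {Φ Ψ : Position}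

theorem legal_of_prefix (A : ConstGame) (h : Φ <+: Ψ) (hΨ : A.Legal Ψ) : A.Legal Φ := by
  obtain ⟨t, rfl⟩ := h
  exact A.legal_of_append _ _ hΨ

namespace LegalRun

theorem of_hasPrefix (h : A.LegalRun Γ) (hΦ : Γ.HasPrefix Φ) : A.Legal Φ := by
  have hlegal := h Φ.length
  rwa [hΦ] at hlegal

theorem not_illegalBy (h : A.LegalRun Γ) (p : Player) : ¬ IllegalBy A.Legal p Γ :=
  fun ⟨_, _, hprefix, _, hillegal⟩ => hillegal (h.of_hasPrefix hprefix)

protected theorem filterMap {f : LabMove → Option LabMove} (h : A.LegalRun Γ)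
    (hf : ∀ Φ, A.Legal Φ → B.Legal (Φ.filterMap f)) : B.LegalRun (Γ.filterMap f) := by
  intro k
  obtain ⟨j, hj⟩ := Run.take_filterMap_prefix f Γ k
  exact B.legal_of_prefix hj (hf _ (h j))

protected theorem neg (h : A.neg.LegalRun Γ) : A.LegalRun Γ.neg := by
  intro k
  rw [Run.neg, seq_take_map]
  exact h k

theorem conj_left (h : (A.conj B).LegalRun Γ) : A.LegalRun Γ.left :=
  h.filterMap fun _ hΦ => hΦ.2.1

theorem conj_right (h : (A.conj B).LegalRun Γ) : B.LegalRun Γ.right :=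
  h.filterMap fun _ hΦ => hΦ.2.2

theorem disj_left (h : (A.disj B).LegalRun Γ) : A.LegalRun Γ.left :=
  h.filterMap fun _ hΦ => hΦ.2.1

theorem disj_right (h : (A.disj B).LegalRun Γ) : B.LegalRun Γ.right :=
  h.filterMap fun _ hΦ => hΦ.2.2

end LegalRun

theorem ofLegal_wn {Legal : Position → Prop} {hnil : Legal []}
    {happ : ∀ Φ Ψ, Legal (Φ ++ Ψ) → Legal Φ} {out : Run → Player}
    (h : (ofLegal Legal hnil happ out).LegalRun Γ) :
    (ofLegal Legal hnil happ out).Wn Γ = out Γ :=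
  (if_neg (h.not_illegalBy .top)).trans (if_neg (h.not_illegalBy .bot))

theorem neg_wn (h : A.neg.LegalRun Γ) : A.neg.Wn Γ = (A.Wn Γ.neg).neg := ofLegal_wn h

theorem conj_wn_eq_top (h : (A.conj B).LegalRun Γ) :
    (A.conj B).Wn Γ = .top ↔ A.Wn Γ.left = .top ∧ B.Wn Γ.right = .top :=
  (ofLegal_wn h).congr_left.trans ite_top_eq_top

theorem disj_wn_eq_top (h : (A.disj B).LegalRun Γ) :
    (A.disj B).Wn Γ = .top ↔ A.Wn Γ.left = .top ∨ B.Wn Γ.right = .top :=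
  (ofLegal_wn h).congr_left.trans ite_top_eq_top

theorem brec_wn_eq_top (h : A.brec.LegalRun Γ) :
    A.brec.Wn Γ = .top ↔ ∀ x, A.Wn (Γ.thread x) = .top := by
  classical exact (ofLegal_wn h).congr_left.trans ite_top_eq_top

/-! ### Adding a legal move -/

/-- The labeled move `m` does not make the position `Φ` of `A` illegal. -/
def CanMove (A : ConstGame) (Φ : Position) (m : LabMove) : Prop := A.Legal Φ → A.Legal (Φ ++ [m])

end ConstGame

theorem ParLegal.append {A B : ConstGame} {Φ : Position} {b : Bool} {p : Player} {α : Move}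
    (h : ParLegal A B Φ) (hα : (bif b then B else A).CanMove (Φ.part b) ⟨p, α⟩) :
    ParLegal A B (Φ ++ [⟨p, tag b ++ α⟩]) := by
  have hpart : ∀ c {C : ConstGame}, C.Legal (Φ.part c) →
      (b = c → C.Legal (Φ.part c ++ [(⟨p, α⟩ : LabMove)])) →
      C.Legal ((Φ ++ [(⟨p, tag b ++ α⟩ : LabMove)]).filterMap (LabMove.strip (tag c))) := by
    intro c C hC hCα
    rw [List.filterMap_append, List.filterMap_cons, strip_tag]
    split_ifs with hbc
    · exact hCα hbc
    · exact (List.append_nil (Φ.part c)).symm ▸ hC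
  refine ⟨fun m hm => ?_, hpart false h.2.1 ?_, hpart true h.2.2 ?_⟩
  · rcases List.mem_append.1 hm with hm | hm
    · exact h.1 m hm
    · rw [List.mem_singleton.1 hm]
      cases b
      exacts [.inl (List.prefix_append _ _), .inr (List.prefix_append _ _)]
  · rintro rfl
    exact hα h.2.1
  · rintro rfl
    exact hα h.2.2

namespace ConstGame.CanMove

variable {A B : ConstGame} {Φ : Position} {b : Bool} {p : Player} {α : Move}

protected theorem neg (h : A.CanMove Φ.neg ⟨p.neg, α⟩) : A.neg.CanMove Φ ⟨p, α⟩ := by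
  intro hΦ
  change A.Legal ((Φ ++ [(⟨p, α⟩ : LabMove)]).map LabMove.neg)
  rw [List.map_append]
  exact h hΦ

protected theorem conj (h : (bif b then B else A).CanMove (Φ.part b) ⟨p, α⟩) :
    (A.conj B).CanMove Φ ⟨p, tag b ++ α⟩ :=
  fun hΦ => ParLegal.append hΦ h

protected theorem disj (h : (bif b then B else A).CanMove (Φ.part b) ⟨p, α⟩) :
    (A.disj B).CanMove Φ ⟨p, tag b ++ α⟩ :=
  fun hΦ => ParLegal.append hΦ h

end ConstGame.CanMove

/-! ### Branching recurrence -/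

/-- The node `w` becomes actual at some point of the run `Θ` of a branching recurrence. -/
def Run.IsActual (Θ : Run) (w : List Bool) : Prop := ∃ k, IsActualNode (Θ.take k) w

theorem IsActualNode.mono {Φ Ψ : Position} {w : List Bool} (h : IsActualNode Φ w) (hs : Φ ⊆ Ψ) :
    IsActualNode Ψ w :=
  h.imp_right fun ⟨u, b, hw, m, hm, hu⟩ => ⟨u, b, hw, m, hs hm, hu⟩

namespace ConstGame

variable {A : ConstGame} {Φ : Position} {Θ : Run} {m : LabMove} {w : List Bool}

theorem brec_legal_append :
    A.brec.Legal (Φ ++ [m]) ↔ A.brec.Legal Φ ∧ BrecLegalMove A Φ m := by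
  refine ⟨fun h => ⟨A.brec.legal_of_append _ _ h, h _ _ List.prefix_rfl⟩, ?_⟩
  rintro ⟨h, hm⟩ Ψ m' hΨ
  rcases List.prefix_concat_iff.1 hΨ with hΨ | hΨ
  · obtain ⟨rfl, hm'⟩ := List.append_inj' hΨ rfl
    rwa [List.singleton_inj.1 hm']
  · exact h _ _ hΨ

theorem brec_legal_thread (h : A.brec.Legal Φ) (x : Stream' Bool) :
    A.Legal (Φ.filterMap (LabMove.stripThread x)) := by
  induction Φ using List.reverseRecOn with
  | nil => exact A.legal_nil
  | append_singleton Φ m ih =>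
    obtain ⟨p, μ⟩ := m
    obtain ⟨hΦ, hm⟩ := brec_legal_append.1 h
    rw [List.filterMap_append, List.filterMap_cons]
    rcases hm with ⟨-, w, -, rfl⟩ | ⟨w, α, -, rfl, hα⟩
    · rw [stripThread_colon]
      simpa using ih hΦ
    · rw [stripThread_dot]
      split_ifs with hx
      · have hthread : w ++ₛ x.drop w.length = x := by
          conv_lhs => rw [← hx, Stream'.length_take, Stream'.append_take_drop]
        exact hthread ▸ hα (x.drop w.length)
      · simpa using ih hΦ

theorem LegalRun.thread (h : A.brec.LegalRun Θ) (x : Stream' Bool) : A.LegalRun (Θ.thread x) :=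
  h.filterMap fun _ hΦ => brec_legal_thread hΦ x

theorem LegalRun.brec_move_cases (h : A.brec.LegalRun Θ) (hm : m ∈ Θ) :
    (∃ w, m.move = bits w ++ [.colon]) ∨ ∃ w α, Θ.IsActual w ∧ m.move = bits w ++ .dot :: α := by
  obtain ⟨k, hk⟩ := mem_seq_iff_mem_take.1 hm
  obtain ⟨Φ, Ψ, hΦ⟩ := List.append_of_mem hk
  have hprefix : Φ ++ [m] <+: Θ.take k := ⟨Ψ, by simp [hΦ]⟩
  rcases h k Φ m hprefix with ⟨-, w, -, hw⟩ | ⟨w, α, hw, hα, -⟩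
  · exact .inl ⟨w, hw⟩
  · exact .inr ⟨w, α, ⟨k, hw.mono ((List.prefix_append _ _).trans hprefix).subset⟩, hα⟩

theorem LegalRun.thread_congr {x y : Stream' Bool} (h : A.brec.LegalRun Θ)
    (hxy : ∀ w, Θ.IsActual w → (x.take w.length = w ↔ y.take w.length = w)) :
    Θ.thread x = Θ.thread y := by
  apply Run.filterMap_congr
  rintro ⟨p, μ⟩ hm
  rcases h.brec_move_cases hm with ⟨w, rfl⟩ | ⟨w, α, hw, rfl⟩
  · rw [stripThread_colon, stripThread_colon]
  · simp only [stripThread_dot, hxy w hw]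

theorem colon_mem_of_isActualNode (h : A.brec.Legal Φ) {u : List Bool} (hw : IsActualNode Φ w)
    (huw : u <+: w) (hne : u ≠ w) : ∃ m ∈ Φ, m.move = bits u ++ [.colon] := by
  induction hn : w.length using Nat.strong_induction_on generalizing w with
  | _ n ih =>
    rcases hw with rfl | ⟨v, b, rfl, m, hm, hmv⟩
    · exact absurd (List.prefix_nil.1 huw) hne
    obtain huv := (List.prefix_concat_iff.1 huw).resolve_left hne
    by_cases hu : u = v
    · exact ⟨m, hm, hu ▸ hmv⟩
    obtain ⟨Ψ, Ψ', rfl⟩ := List.append_of_mem hm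
    refine ih v.length (by simp [← hn]) (w := v) ?_ huv hu rfl
    rcases h Ψ m ⟨Ψ', by simp⟩ with ⟨-, v', hv', hmv'⟩ | ⟨v', α, -, hmv', -⟩
    · obtain rfl := bits_append_colon_inj.1 (hmv.symm.trans hmv')
      exact hv'.1.mono (List.subset_append_left _ _)
    · exact absurd (hmv'.symm.trans hmv) bits_append_dot_ne_colon

theorem CanMove.brec {p : Player} {α : Move} (hw : IsActualNode Φ w)
    (hα : ∀ Ψ, A.CanMove Ψ ⟨p, α⟩) : A.brec.CanMove Φ ⟨p, bits w ++ .dot :: α⟩ := fun hΦ =>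
  brec_legal_append.2
    ⟨hΦ, .inr ⟨w, α, hw, rfl, fun v => hα _ (brec_legal_thread hΦ (w ++ₛ v))⟩⟩

theorem CanMove.brec_split (hw : IsActualNode Φ w)
    (hsplit : ∀ m ∈ Φ, m.move ≠ bits w ++ [.colon]) :
    A.brec.CanMove Φ ⟨.bot, bits w ++ [.colon]⟩ := by
  refine fun hΦ => brec_legal_append.2 ⟨hΦ, .inl ⟨rfl, w, ⟨hw, fun w' hw' hp => ?_⟩, rfl⟩⟩
  by_contra hne
  obtain ⟨m, hm, hm'⟩ := colon_mem_of_isActualNode hΦ hw' hp (Ne.symm hne)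
  exact hsplit m hm hm'

end ConstGame

/-! ### Enumeration games -/

theorem getElem?_filter {α : Type*} {P : α → Bool} {l : List α} {n : ℕ} {a : α} :
    (l.filter P)[n]? = some a ↔ ∃ i, l[i]? = some a ∧ P a ∧ (l.take i).countP P = n := by
  induction l generalizing n with
  | nil => simp
  | cons b l ih =>
    rw [← Nat.or_exists_add_one]
    by_cases hb : P b <;> cases n <;> simp [hb, ih] <;> grind

theorem Run.get?_movesOf {p : Player} {Γ : Run} {n : ℕ} {m : LabMove} :
    (Γ.movesOf p).get? n = some m ↔
      ∃ i, Γ.get? i = some m ∧ m.player = p ∧ Γ.IsNthMoveOf p n i := by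
  have hfilter : ∀ k, (Γ.take k).filterMap (fun m => if m.player = p then some m else none) =
      (Γ.take k).filter (fun m => m.player = p) := fun k => by
    rw [← List.filterMap_eq_filter]
    congr
    funext m
    simp [Option.guard]
  rw [Run.movesOf, Run.filterMap, (isGrowing_filterMap_take _ Γ).get?_limit]
  simp only [hfilter, getElem?_filter, Stream'.Seq.getElem?_take, Option.ite_none_right_eq_some,
    decide_eq_true_eq]
  constructor
  · rintro ⟨k, i, ⟨hik, hi⟩, rfl, hn⟩
    rw [take_seq_take hik.le] at hn
    exact ⟨i, hi, rfl, ⟨m.move, hi⟩, hn⟩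
  · rintro ⟨i, hi, hp, -, hn⟩
    exact ⟨i + 1, i, ⟨i.lt_succ_self, hi⟩, hp, (take_seq_take i.le_succ).symm ▸ hn⟩

theorem IsDelay.mem_iff {p : Player} {Γ Δ : Run} {m : LabMove} (h : IsDelay p Γ Δ) :
    m ∈ Γ ↔ m ∈ Δ := by
  have hmem : ∀ Θ : Run, m ∈ Θ ↔ m ∈ Θ.movesOf m.player := fun Θ => by
    simp only [Run.movesOf, Run.mem_filterMap]
    grind
  rw [hmem Γ, hmem Δ, h.1]

theorem Run.exists_isNthMoveOf_of_movesOf_eq {Γ Δ : Run} {m : LabMove} {i : ℕ}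
    (h : Γ.movesOf m.player = Δ.movesOf m.player) (hi : Γ.get? i = some m) :
    ∃ n j, Γ.IsNthMoveOf m.player n i ∧ Δ.get? j = some m ∧ Δ.IsNthMoveOf m.player n j := by
  have hn : Γ.IsNthMoveOf m.player _ i := ⟨⟨m.move, hi⟩, rfl⟩
  have hget := Run.get?_movesOf.2 ⟨i, hi, rfl, hn⟩
  rw [h] at hget
  obtain ⟨j, hj, -, hjn⟩ := Run.get?_movesOf.1 hget
  exact ⟨_, j, hn, hj, hjn⟩

theorem ConstGame.exists_first_illegal {A : ConstGame} {Γ : Run} (h : ¬ A.LegalRun Γ) :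
    ∃ i m, Γ.get? i = some m ∧ A.Legal (Γ.take i) ∧ ¬ A.Legal (Γ.take i ++ [m]) := by
  contrapose! h
  intro k
  induction k with
  | zero => exact A.legal_nil
  | succ k ih =>
    cases hk : Γ.get? k with
    | some m => exact seq_take_succ hk ▸ h k m hk ih
    | none =>
      have htake : Γ.take (k + 1) = Γ.take k := by
        ext1 i
        simp only [Stream'.Seq.getElem?_take]
        grind
      exact htake ▸ ih

namespace ConstGame.IsEnumeration

variable {A : ConstGame} (hA : A.IsEnumeration) {Γ Δ : Run}
include hA

theorem legalRun_iff : A.LegalRun Γ ↔ ∀ m ∈ Γ, ∃ n, m.move = decimal n := by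
  simp only [ConstGame.LegalRun, hA.1, mem_seq_iff_mem_take (s := Γ), forall_exists_index]
  exact forall_comm

theorem exists_first_illegal (h : ¬ A.LegalRun Γ) :
    ∃ i m, Γ.get? i = some m ∧ (¬ ∃ n, m.move = decimal n) ∧
      (∀ j < i, ∀ m', Γ.get? j = some m' → ∃ n, m'.move = decimal n) ∧
      A.Wn Γ = m.player.neg := by
  obtain ⟨i, m, hm, hlegal, hillegal⟩ := ConstGame.exists_first_illegal h
  refine ⟨i, m, hm, fun hn => hillegal ((hA.1 _).2 fun m' hm' => ?_), fun j hj m' hm' =>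
    (hA.1 _).1 hlegal m' (mem_seq_take.2 ⟨j, hj, hm'⟩),
    A.wn_of_illegal Γ _ m (seq_take_succ hm ▸ Γ.hasPrefix_take _) hlegal hillegal⟩
  rcases List.mem_append.1 hm' with hm' | hm'
  · exact (hA.1 _).1 hlegal m' hm'
  · rwa [List.mem_singleton.1 hm']

theorem static : A.Static := by
  intro p Γ Δ h hΓ
  have hlegal : A.LegalRun Γ ↔ A.LegalRun Δ := by simp only [hA.legalRun_iff, h.mem_iff]
  by_cases hl : A.LegalRun Γ
  · refine hΓ ▸ (hA.2 Γ Δ hl (hlegal.1 hl) fun q => ?_).symm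
    ext n
    exact (mem_seq_iff_get?.symm.trans h.mem_iff).trans mem_seq_iff_get?
  · obtain ⟨j, m, hj, hbad, hmin, hwn⟩ := hA.exists_first_illegal hl
    obtain ⟨i', m', hi', hbad', hmin', hwn'⟩ := hA.exists_first_illegal (mt hlegal.2 hl)
    rw [hwn']
    by_contra hne
    -- The adversary of `p` makes the first illegal move of `Γ`, and `p` that of `Δ`. In `Γ`, the
    -- former comes before the latter, hence also in the delay `Δ`: so `p` was not the first.
    have hm : m.player = p.neg := by rw [← hΓ, hwn, Player.neg_neg]
    have hm' : m'.player = p := by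
      rw [← Player.neg_neg m'.player, Player.ne_iff_eq_neg.1 hne, Player.neg_neg]
    obtain ⟨n, i, hn', hi, hn⟩ := Run.exists_isNthMoveOf_of_movesOf_eq (h.1 _).symm hi'
    obtain ⟨k, j', hk, hj', hk'⟩ := Run.exists_isNthMoveOf_of_movesOf_eq (h.1 _) hj
    rw [hm'] at hn hn'
    rw [hm] at hk hk'
    have hji : j < i := by
      rcases lt_trichotomy j i with hlt | rfl | hlt
      · exact hlt
      · obtain rfl := Option.some_injective _ (hi.symm.trans hj)
        exact absurd (hm'.symm.trans hm) (by cases p <;> decide)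
      · exact absurd (hmin i hlt m' hi) hbad'
    exact hbad (hmin' j' (h.2 n k i j hn hk hji i' j' hn' hk') m hj')

end ConstGame.IsEnumeration

/-- The sets of numbers enumerated by the machine and by the environment, which determine the winner
of a legal run of an enumeration game. -/
def Run.value (Γ : Run) : Set ℕ × Set ℕ := (Γ.enumerated .top, Γ.enumerated .bot)

theorem Run.decimal_mem_iff_of_value_eq {Γ Δ : Run} (h : Γ.value = Δ.value) (n : ℕ) :
    ⟨.bot, decimal n⟩ ∈ Γ ↔ ⟨.bot, decimal n⟩ ∈ Δ := by
  rw [mem_seq_iff_get?, mem_seq_iff_get?]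
  exact Set.ext_iff.1 (congrArg Prod.snd h) n

open Classical in
/-- The enumeration game in which the machine has to reach one of the values in `T`. -/
noncomputable def enumGame (T : Set (Set ℕ × Set ℕ)) : ConstGame :=
  .ofLegal (fun Φ => ∀ m ∈ Φ, ∃ n, m.move = decimal n) (by simp)
    (fun _ _ h m hm => h m (List.mem_append_left _ hm))
    fun Γ => if Γ.value ∈ T then .top else .bot

section EnumGame

variable {T : Set (Set ℕ × Set ℕ)} {Γ : Run}

theorem enumGame_wn_eq_top (h : (enumGame T).LegalRun Γ) :
    (enumGame T).Wn Γ = .top ↔ Γ.value ∈ T := by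
  classical exact (ConstGame.ofLegal_wn h).congr_left.trans ite_top_eq_top

theorem enumGame_canMove (Φ : Position) (p : Player) (n : ℕ) :
    (enumGame T).CanMove Φ ⟨p, decimal n⟩ := by
  intro h m hm
  rcases List.mem_append.1 hm with hm | hm
  · exact h m hm
  · exact ⟨n, by rw [List.mem_singleton.1 hm]⟩

theorem isEnumeration_enumGame (T : Set (Set ℕ × Set ℕ)) : (enumGame T).IsEnumeration := by
  refine ⟨fun Φ => Iff.rfl, fun Γ Δ hΓ hΔ h => ?_⟩
  have hvalue : Γ.value = Δ.value := by rw [Run.value, Run.value, h, h]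
  exact ((ConstGame.ofLegal_wn hΓ).trans (by rw [hvalue])).trans (ConstGame.ofLegal_wn hΔ).symm

end EnumGame

/-! ### A fair environment -/

instance : Countable Key :=
  Function.Injective.countable (β := ℕ × ℕ)
    (f := fun | .digit d => (0, d) | .dot => (1, 0) | .colon => (2, 0) | .other k => (3, k))
    fun k l h => by cases k <;> cases l <;> simp_all only [Prod.mk.injEq, Fin.val_inj] <;> simp_all

/-- The position obtained from `Φ` by moves of the environment. -/
def Position.reply (Φ : Position) (Ψ : List Move) : Position := Φ ++ Ψ.map fun α => ⟨.bot, α⟩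

namespace HPM

variable (H : HPM) (e : Valuation) (σ : ℕ → Position → List Move)

/-- The computation branch of `H` on `e` in which the environment follows the strategy `σ`: in step
`i` it makes the moves `σ i Φ`, where `Φ` is the position including the move that the machine makes
in that step. -/
noncomputable def branchAgainst : ℕ → H.Config
  | 0 => H.init
  | i + 1 =>
    let C := branchAgainst i
    H.next e C (σ i (C.position ++ C.machineMove))

/-- The position in step `i` against the strategy `σ`, after the move of the machine and before
those of the environment. -/
noncomputable def turnAgainst (i : ℕ) : Position :=
  (H.branchAgainst e σ i).position ++ (H.branchAgainst e σ i).machineMove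

/-- The run generated by `H` on `e` against the strategy `σ` of the environment. -/
noncomputable def runAgainst : Run := Run.limit fun i => (H.branchAgainst e σ i).position

theorem generates_runAgainst : H.Generates e (H.runAgainst e σ) :=
  ⟨H.branchAgainst e σ, ⟨rfl, fun _ => ⟨_, rfl⟩⟩, rfl⟩

variable {H e σ}

theorem position_branchAgainst_succ (i : ℕ) : (H.branchAgainst e σ (i + 1)).position =
    (H.turnAgainst e σ i).reply (σ i (H.turnAgainst e σ i)) :=
  rfl

theorem turnAgainst_prefix (i : ℕ) :
    H.turnAgainst e σ i <+: (H.branchAgainst e σ (i + 1)).position :=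
  List.prefix_append _ _

variable (H e σ) in
theorem isGrowing_branchAgainst : IsGrowing fun i => (H.branchAgainst e σ i).position :=
  isGrowing_of_succ fun i => (List.prefix_append _ _).trans (turnAgainst_prefix i)

theorem hasPrefix_turnAgainst (i : ℕ) : (H.runAgainst e σ).HasPrefix (H.turnAgainst e σ i) :=
  ((isGrowing_branchAgainst H e σ).hasPrefix_limit (i + 1)).of_prefix (turnAgainst_prefix i)

theorem exists_mem_of_mem_runAgainst {α : Move} (h : ⟨.bot, α⟩ ∈ H.runAgainst e σ) :
    ∃ i, α ∈ σ i (H.turnAgainst e σ i) := by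
  obtain ⟨i, hi⟩ := (isGrowing_branchAgainst H e σ).mem_limit.1 h
  induction i with
  | zero => cases hi
  | succ i ih =>
    rw [position_branchAgainst_succ, Position.reply, List.mem_append, turnAgainst,
      List.mem_append] at hi
    rcases hi with (hi | hi) | hi
    · exact ih hi
    · unfold Config.machineMove at hi
      split_ifs at hi <;> simp at hi
    · obtain ⟨β, hβ, hα⟩ := List.mem_map.1 hi
      exact ⟨i, (LabMove.mk.inj hα).2 ▸ hβ⟩

theorem illegalBy_or_legalRun_runAgainst {A : ConstGame}
    (hσ : ∀ i Φ, A.Legal Φ → A.Legal (Φ.reply (σ i Φ))) :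
    IllegalBy A.Legal .top (H.runAgainst e σ) ∨ A.LegalRun (H.runAgainst e σ) := by
  by_cases hex : ∃ i, A.Legal (H.branchAgainst e σ i).position ∧ ¬ A.Legal (H.turnAgainst e σ i)
  · obtain ⟨i, hlegal, hillegal⟩ := hex
    have hprefix := hasPrefix_turnAgainst (H := H) (e := e) (σ := σ) i
    unfold turnAgainst Config.machineMove at hillegal hprefix
    split_ifs at hillegal hprefix
    · exact .inl ⟨_, _, hprefix, hlegal, hillegal⟩
    · exact absurd ((List.append_nil _).symm ▸ hlegal) hillegal
  · push Not at hex
    have hlegal : ∀ i, A.Legal (H.branchAgainst e σ i).position := fun i => by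
      induction i with
      | zero => exact A.legal_nil
      | succ i ih => exact hσ i _ (hex i ih)
    refine .inr fun k => ?_
    obtain ⟨i, hi⟩ := (isGrowing_branchAgainst H e σ).exists_prefix_of_hasPrefix_limit
      ((H.runAgainst e σ).hasPrefix_take k)
    exact A.legal_of_prefix hi (hlegal i)

end HPM

/-- A legal run of `A` in which the environment only makes moves from `M`, and makes all of them
that are legal from some time on. -/
structure Run.IsFair (A : ConstGame) (M : Set Move) (Γ : Run) : Prop where
  legal : A.LegalRun Γ
  mem_of_bot : ∀ α, ⟨.bot, α⟩ ∈ Γ → α ∈ M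
  made : ∀ α ∈ M, (∀ᶠ k in atTop, A.CanMove (Γ.take k) ⟨.bot, α⟩) → ⟨.bot, α⟩ ∈ Γ

open Classical in
/-- The strategy that in step `i` makes the move `s c`, where `c` is the first of the two numbers
that `i` encodes, if it is in `M` and legal: so every move of `M` is attempted again and again. -/
noncomputable def fairStrategy (A : ConstGame) (M : Set Move) (s : ℕ → Move) (i : ℕ)
    (Φ : Position) : List Move :=
  if s i.unpair.1 ∈ M ∧ A.Legal (Φ.reply [s i.unpair.1]) then [s i.unpair.1] else []

section Fairness

variable {A : ConstGame} {M : Set Move} {s : ℕ → Move}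

theorem legal_reply_fairStrategy (i : ℕ) (Φ : Position) (h : A.Legal Φ) :
    A.Legal (Φ.reply (fairStrategy A M s i Φ)) := by
  unfold fairStrategy
  split_ifs with hi
  · exact hi.2
  · simpa only [Position.reply, List.map_nil, List.append_nil] using h

theorem isFair_runAgainst_fairStrategy {H : HPM} {e : Valuation} (hs : s.Surjective)
    (hlegal : A.LegalRun (H.runAgainst e (fairStrategy A M s))) :
    (H.runAgainst e (fairStrategy A M s)).IsFair A M where
  legal := hlegal
  mem_of_bot α hα := by
    obtain ⟨i, hi⟩ := HPM.exists_mem_of_mem_runAgainst hα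
    unfold fairStrategy at hi
    split_ifs at hi with h
    · exact List.mem_singleton.1 hi ▸ h.1
    · cases hi
  made α hα hmove := by
    have hR := HPM.isGrowing_branchAgainst H e (fairStrategy A M s)
    obtain ⟨k, hk⟩ := eventually_atTop.1 hmove
    obtain ⟨i, hi⟩ := hR.exists_prefix_of_hasPrefix_limit (Run.hasPrefix_take _ k)
    obtain ⟨c, rfl⟩ := hs α
    have hprefix := HPM.hasPrefix_turnAgainst (H := H) (e := e) (σ := fairStrategy A M s)
      (Nat.pair c i)
    obtain ⟨j, hkj, hj⟩ := hprefix.exists_take_eq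
      ((hi.trans (hR (Nat.right_le_pair c i))).trans (List.prefix_append _ _))
    refine hR.mem_limit.2 ⟨Nat.pair c i + 1, ?_⟩
    have hreply := hk j hkj (hlegal j)
    rw [hj] at hreply
    have hstrategy : fairStrategy A M s (Nat.pair c i)
        (H.turnAgainst e (fairStrategy A M s) (Nat.pair c i)) = [s c] := by
      rw [fairStrategy, Nat.unpair_pair, if_pos ⟨hα, hreply⟩]
    rw [HPM.position_branchAgainst_succ, hstrategy]
    exact List.mem_append_right _ (List.mem_singleton_self _)

end Fairness

theorem HPM.exists_fair_run (H : HPM) (e : Valuation) (A : ConstGame) (M : Set Move) :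
    ∃ Γ, H.Generates e Γ ∧ (IllegalBy A.Legal .top Γ ∨ Γ.IsFair A M) := by
  obtain ⟨s, hs⟩ := exists_surjective_nat Move
  exact ⟨H.runAgainst e (fairStrategy A M s), H.generates_runAgainst e _,
    (illegalBy_or_legalRun_runAgainst legal_reply_fairStrategy).imp_right
      (isFair_runAgainst_fairStrategy hs)⟩

/-! ### Long production -/

namespace ConstGame

/-- The implication `A → B`. -/
noncomputable def imp (A B : ConstGame) : ConstGame := A.neg.disj B

/-- The antecedent of long production. -/
noncomputable def longProductionAntecedent (A : ConstGame) : ConstGame :=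
  (A.conj (A.imp (A.conj A)).brec).conj ((A.disj A).imp A).brec

/-- The value of the long production formula for the value `A` of its letter. -/
noncomputable def longProduction (A : ConstGame) : ConstGame :=
  A.longProductionAntecedent.imp A.brec

theorem imp_wn_eq_top {A B : ConstGame} {Γ : Run} (h : (A.imp B).LegalRun Γ) :
    (A.imp B).Wn Γ = .top ↔ (A.Wn Γ.left.neg = .top → B.Wn Γ.right = .top) := by
  rw [imp, disj_wn_eq_top h, neg_wn h.disj_left, Player.neg_eq_iff, ← Player.ne_iff_eq_neg,
    imp_iff_not_or]

end ConstGame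

/-- The occurrences of the letter in long production under a recurrence that the environment marks:
the one in the succedent, the antecedent of `P → P ∧ P`, and the left (`false`) or right (`true`)
disjunct in the antecedent of `P ∨ P → P`. -/
inductive Occurrence where
  | succedent
  | dup
  | merge (b : Bool)

namespace Occurrence

/-- The game under the recurrence that contains the occurrence. -/
noncomputable def body (A : ConstGame) : Occurrence → ConstGame
  | succedent => A
  | dup => A.imp (A.conj A)
  | merge _ => (A.disj A).imp A

/-- The play in the recurrence that contains the occurrence. In the antecedent of long production
the players have switched roles there, so that the environment is `⊤`. -/
noncomputable def play (Γ : Run) : Occurrence → Run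
  | succedent => Γ.right
  | dup => Γ.left.neg.left.right
  | merge _ => Γ.left.neg.right

/-- `Occurrence.play` for positions. -/
def playPosition (Φ : Position) : Occurrence → Position
  | succedent => Φ.part true
  | dup => ((Φ.part false).neg.part false).part true
  | merge _ => (Φ.part false).neg.part true

/-- The play in the copy of the letter that the occurrence has in the thread `x`. -/
noncomputable def copy (Γ : Run) (o : Occurrence) (x : Stream' Bool) : Run :=
  match o, (o.play Γ).thread x with
  | succedent, Θ => Θ
  | dup, Θ => Θ.left.neg
  | merge b, Θ => Θ.left.neg.part b

/-- The move in long production that makes the move `α` in all copies of the letter that the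
occurrence has in the threads through the node `w`. -/
def move (w : List Bool) (α : Move) : Occurrence → Move
  | succedent => tag true ++ (bits w ++ .dot :: α)
  | dup => tag false ++ (tag false ++ (tag true ++ (bits w ++ .dot :: (tag false ++ α))))
  | merge b => tag false ++ (tag true ++ (bits w ++ .dot :: (tag false ++ (tag b ++ α))))

theorem move_inj {o o' : Occurrence} {u w : List Bool} {α β : Move} :
    o.move u α = o'.move w β ↔ o = o' ∧ u = w ∧ α = β := by
  cases o <;> cases o' <;>
    simp only [move, tag_append_inj, bits_append_dot_inj, merge.injEq, reduceCtorEq] <;> tauto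

theorem move_ne_split {o : Occurrence} {u w : List Bool} {α : Move} :
    o.move u α ≠ tag true ++ (bits w ++ [.colon]) := by
  cases o <;> simp [move, tag_append_inj, bits_append_dot_ne_colon]

theorem mem_copy {Γ : Run} {o : Occurrence} {x : Stream' Bool} {m : LabMove} :
    m ∈ o.copy Γ x ↔ ∃ n, ⟨m.player, o.move (x.take n) m.move⟩ ∈ Γ := by
  cases o <;>
    simp only [copy, play, move, Run.mem_neg, Run.mem_part, Run.mem_thread, LabMove.neg,
      Player.neg_neg]

theorem eventually_mem_playPosition {Γ : Run} {o : Occurrence} {m : LabMove} (h : m ∈ o.play Γ) :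
    ∀ᶠ k in atTop, m ∈ o.playPosition (Γ.take k) := by
  cases o <;>
    simp only [play, playPosition, Run.mem_neg, Run.mem_part, Position.mem_neg,
      Position.mem_part] at h ⊢ <;>
    exact eventually_mem_seq_take h

theorem legalRun_play {A : ConstGame} {Γ : Run} (h : A.longProduction.LegalRun Γ) :
    ∀ o : Occurrence, (o.body A).brec.LegalRun (o.play Γ)
  | succedent => h.disj_right
  | dup => h.disj_left.neg.conj_left.conj_right
  | merge _ => h.disj_left.neg.conj_right

theorem canMove_move {A : ConstGame} {Φ : Position} {o : Occurrence} {w : List Bool} {α : Move}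
    (hw : IsActualNode (o.playPosition Φ) w) (hα : ∀ p Ψ, A.CanMove Ψ ⟨p, α⟩) :
    A.longProduction.CanMove Φ ⟨.bot, o.move w α⟩ := by
  cases o with
  | succedent => exact .disj (.brec hw (hα _))
  | dup => exact .disj (.neg (.conj (.conj (.brec hw fun Ψ => .disj (.neg (hα _ _))))))
  | merge b =>
    refine .disj (.neg (.conj (.brec hw fun Ψ => .disj (.neg (.disj ?_)))))
    cases b <;> exact hα _ _

end Occurrence

/-- The number by which the environment marks the node `w`, as a move. -/
def mark (w : List Bool) : Move := decimal (Encodable.encode w)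

theorem mark_injective : Function.Injective mark :=
  decimal_injective.comp Encodable.encode_injective

/-- The moves of the environment: it splits every thread of the succedent, and in every occurrence
it marks each node. -/
def markingMoves : Set Move :=
  Set.range (fun w => tag true ++ (bits w ++ [.colon])) ∪
    Set.range fun i : Occurrence × List Bool => i.1.move i.2 (mark i.2)

theorem eq_of_move_mem_markingMoves {o : Occurrence} {u w : List Bool}
    (h : o.move u (mark w) ∈ markingMoves) : u = w := by
  rcases h with ⟨v, hv⟩ | ⟨⟨o', v⟩, hv⟩
  · exact absurd hv.symm Occurrence.move_ne_split
  · obtain ⟨-, hvu, hmark⟩ := Occurrence.move_inj.1 hv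
    exact hvu.symm.trans (mark_injective hmark)

theorem eventually_isActualNode_playPosition {Γ : Run} {o : Occurrence} {w : List Bool}
    (hw : (o.play Γ).IsActual w) : ∀ᶠ k in atTop, IsActualNode (o.playPosition (Γ.take k)) w := by
  obtain ⟨k, rfl | ⟨u, b, rfl, m, hm, hu⟩⟩ := hw
  · exact .of_forall fun _ => .inl rfl
  · filter_upwards [Occurrence.eventually_mem_playPosition (mem_seq_iff_mem_take.2 ⟨k, hm⟩)]
      with j hj
    exact .inr ⟨u, b, rfl, m, hj, hu⟩

namespace Run.IsFair

variable {T : Set (Set ℕ × Set ℕ)} {Γ : Run}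

theorem change_enumGame (hΓ : Γ.IsFair (enumGame T).longProduction markingMoves)
    (T' : Set (Set ℕ × Set ℕ)) : Γ.IsFair (enumGame T').longProduction markingMoves :=
  ⟨hΓ.legal, hΓ.mem_of_bot, hΓ.made⟩

variable (hΓ : Γ.IsFair (enumGame T).longProduction markingMoves)

include hΓ

theorem move_mark_mem {o : Occurrence} {w : List Bool} (hw : (o.play Γ).IsActual w) :
    ⟨.bot, o.move w (mark w)⟩ ∈ Γ := by
  refine hΓ.made _ (.inr ⟨(o, w), rfl⟩) ?_
  filter_upwards [eventually_isActualNode_playPosition hw] with k hk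
  exact Occurrence.canMove_move hk fun p Φ => enumGame_canMove Φ p _

theorem isActual_succedent (w : List Bool) : (Occurrence.succedent.play Γ).IsActual w := by
  induction w using List.reverseRecOn with
  | nil => exact ⟨0, .inl rfl⟩
  | append_singleton w b ih =>
    obtain ⟨m, hm, hw⟩ : ∃ m ∈ Γ.right, m.move = bits w ++ [.colon] := by
      by_contra! hsplit
      refine hsplit ⟨.bot, _⟩ (Run.mem_part.2 (hΓ.made _ (.inl ⟨w, rfl⟩) ?_)) rfl
      filter_upwards [eventually_isActualNode_playPosition ih] with k hk
      exact .disj (.brec_split hk fun m hm => hsplit m (Run.mem_part.2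
        (mem_seq_iff_mem_take.2 ⟨k, Position.mem_part.1 hm⟩)))
    obtain ⟨k, hk⟩ := mem_seq_iff_mem_take.1 hm
    exact ⟨k, .inr ⟨w, b, rfl, m, hk, hw⟩⟩

theorem mark_mem_copy {o : Occurrence} {w : List Bool} (hw : (o.play Γ).IsActual w)
    {x : Stream' Bool} : ⟨.bot, mark w⟩ ∈ o.copy Γ x ↔ x.take w.length = w := by
  rw [Occurrence.mem_copy]
  constructor
  · rintro ⟨n, hn⟩
    obtain rfl := eq_of_move_mem_markingMoves (hΓ.mem_of_bot _ hn)
    rw [Stream'.length_take]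
  · intro hx
    exact ⟨w.length, hx.symm ▸ hΓ.move_mark_mem hw⟩

theorem take_eq_iff_of_value_eq {o : Occurrence} {x y : Stream' Bool}
    (hxy : (o.copy Γ x).value = (o.copy Γ y).value) {w : List Bool} (hw : (o.play Γ).IsActual w) :
    x.take w.length = w ↔ y.take w.length = w := by
  rw [← hΓ.mark_mem_copy hw, ← hΓ.mark_mem_copy hw]
  exact Run.decimal_mem_iff_of_value_eq hxy _

theorem thread_eq_of_value_eq {o : Occurrence} {x y : Stream' Bool}
    (hxy : (o.copy Γ x).value = (o.copy Γ y).value) :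
    (o.play Γ).thread x = (o.play Γ).thread y :=
  (Occurrence.legalRun_play hΓ.legal o).thread_congr fun _ => hΓ.take_eq_iff_of_value_eq hxy

theorem injective_value_succedent :
    Function.Injective fun x => (Occurrence.succedent.copy Γ x).value := by
  intro x y hxy
  refine Stream'.take_theorem _ _ fun n => ?_
  have htake := hΓ.take_eq_iff_of_value_eq hxy (hΓ.isActual_succedent (y.take n))
  simpa only [Stream'.length_take, iff_true] using htake

end Run.IsFair

/-! ### Forced values -/

theorem countable_setOf_reflTransGen {α : Type*} {r : α → α → Prop}
    (h : ∀ a, {b | r a b}.Countable) (a : α) : {b | Relation.ReflTransGen r a b}.Countable := by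
  let level : ℕ → Set α := fun n => Nat.rec {a} (fun _ S => ⋃ c ∈ S, {b | r c b}) n
  have hlevel : ∀ n, (level n).Countable := fun n => by
    induction n with
    | zero => exact Set.countable_singleton a
    | succ n ih => exact ih.biUnion fun c _ => h c
  refine (Set.countable_iUnion hlevel).mono fun b hb => ?_
  induction hb with
  | refl => exact Set.mem_iUnion.2 ⟨0, rfl⟩
  | tail _ hbc ih =>
    obtain ⟨n, hn⟩ := Set.mem_iUnion.1 ih
    exact Set.mem_iUnion.2 ⟨n + 1, Set.mem_iUnion₂.2 ⟨_, hn, hbc⟩⟩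

theorem subsingleton_image_fiber {α β γ : Type*} {f : α → β} {g : α → γ}
    (h : g.FactorsThrough f) (b : β) : (g '' {a | f a = b}).Subsingleton := by
  rintro _ ⟨x, hx, rfl⟩ _ ⟨y, hy, rfl⟩
  exact h (hx.trans hy.symm)

instance : Uncountable (Stream' Bool) := by
  change Uncountable (ℕ → Bool)
  rw [← Cardinal.aleph0_lt_mk_iff]
  simpa using Cardinal.cantor Cardinal.aleph0

/-- The play in a conjunct of the succedent of `P → P ∧ P`, in the thread `x`. -/
noncomputable def dupOutput (Γ : Run) (b : Bool) (x : Stream' Bool) : Run :=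
  ((Occurrence.dup.play Γ).thread x).right.part b

/-- The play in the succedent of `P ∨ P → P`, in the thread `x`. -/
noncomputable def mergeOutput (Γ : Run) (x : Stream' Bool) : Run :=
  (Γ.left.neg.right.thread x).right

/-- To win the antecedent of long production when it wins the value `a`, the environment has to win
the value `c`: some thread of a recurrence in the antecedent turns `a` into `c`. -/
inductive Forces (Γ : Run) : Set ℕ × Set ℕ → Set ℕ × Set ℕ → Prop
  | dup (b : Bool) (x : Stream' Bool) :
    Forces Γ (Occurrence.dup.copy Γ x).value (dupOutput Γ b x).value
  | merge (b : Bool) (x : Stream' Bool) :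
    Forces Γ ((Occurrence.merge b).copy Γ x).value (mergeOutput Γ x).value

/-- The values that the environment has to win, starting from that of the first conjunct of the
antecedent. -/
def forcedValues (Γ : Run) : Set (Set ℕ × Set ℕ) :=
  {v | Relation.ReflTransGen (Forces Γ) Γ.left.neg.left.left.value v}

namespace Run.IsFair

variable {T : Set (Set ℕ × Set ℕ)} {Γ : Run}
  (hΓ : Γ.IsFair (enumGame T).longProduction markingMoves)

include hΓ

theorem countable_forces (a : Set ℕ × Set ℕ) : {c | Forces Γ a c}.Countable := by
  have hdup : ∀ b, (fun x => (dupOutput Γ b x).value).FactorsThrough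
      fun x => (Occurrence.dup.copy Γ x).value := fun b x y hxy => by
    simp only [dupOutput, hΓ.thread_eq_of_value_eq hxy]
  have hmerge : ∀ b, (fun x => (mergeOutput Γ x).value).FactorsThrough
      fun x => ((Occurrence.merge b).copy Γ x).value := fun b x y hxy =>
    congrArg (fun Θ : Run => Θ.right.value) (hΓ.thread_eq_of_value_eq hxy)
  refine ((Set.countable_iUnion fun b => (subsingleton_image_fiber (hdup b) a).countable).union
    (Set.countable_iUnion fun b => (subsingleton_image_fiber (hmerge b) a).countable)).mono ?_
  rintro _ (⟨b, x⟩ | ⟨b, x⟩)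
  · exact .inl (Set.mem_iUnion.2 ⟨b, x, rfl, rfl⟩)
  · exact .inr (Set.mem_iUnion.2 ⟨b, x, rfl, rfl⟩)

theorem countable_forcedValues : (forcedValues Γ).Countable :=
  countable_setOf_reflTransGen hΓ.countable_forces _

theorem exists_value_succedent_notMem_forcedValues :
    ∃ x, (Occurrence.succedent.copy Γ x).value ∉ forcedValues Γ := by
  by_contra! hforced
  have huniv : (fun x => (Occurrence.succedent.copy Γ x).value) ⁻¹' forcedValues Γ = Set.univ :=
    Set.eq_univ_of_forall hforced
  have hcountable := hΓ.countable_forcedValues.preimage hΓ.injective_value_succedent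
  rw [huniv, Set.countable_univ_iff] at hcountable
  exact not_countable (α := Stream' Bool) hcountable

end Run.IsFair

/-! ### The environment defeats long production -/

section Winner

variable {Γ : Run} {T : Set (Set ℕ × Set ℕ)} (h : (enumGame T).longProduction.LegalRun Γ)
  (hT : ∀ a c, Forces Γ a c → a ∈ T → c ∈ T)

include h hT

theorem dup_wn_eq_top (x : Stream' Bool) :
    (Occurrence.dup.body (enumGame T)).Wn ((Occurrence.dup.play Γ).thread x) = .top := by
  have hx : ((enumGame T).imp ((enumGame T).conj (enumGame T))).LegalRun _ :=
    (Occurrence.legalRun_play h .dup).thread x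
  rw [Occurrence.body, ConstGame.imp_wn_eq_top hx, enumGame_wn_eq_top hx.disj_left.neg,
    ConstGame.conj_wn_eq_top hx.disj_right, enumGame_wn_eq_top hx.disj_right.conj_left,
    enumGame_wn_eq_top hx.disj_right.conj_right]
  exact fun ha => ⟨hT _ _ (.dup false x) ha, hT _ _ (.dup true x) ha⟩

theorem merge_wn_eq_top (b : Bool) (x : Stream' Bool) :
    ((Occurrence.merge b).body (enumGame T)).Wn (((Occurrence.merge b).play Γ).thread x) =
      .top := by
  have hx : (((enumGame T).disj (enumGame T)).imp (enumGame T)).LegalRun _ :=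
    (Occurrence.legalRun_play h (.merge b)).thread x
  rw [Occurrence.body, ConstGame.imp_wn_eq_top hx, ConstGame.disj_wn_eq_top hx.disj_left.neg,
    enumGame_wn_eq_top hx.disj_left.neg.disj_left, enumGame_wn_eq_top hx.disj_left.neg.disj_right,
    enumGame_wn_eq_top hx.disj_right]
  rintro (ha | ha)
  exacts [hT _ _ (.merge false x) ha, hT _ _ (.merge true x) ha]

theorem longProductionAntecedent_wn_eq_top (hbase : Γ.left.neg.left.left.value ∈ T) :
    (enumGame T).longProductionAntecedent.Wn Γ.left.neg = .top := by
  have hleft : (enumGame T).longProductionAntecedent.LegalRun Γ.left.neg := h.disj_left.neg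
  rw [ConstGame.longProductionAntecedent, ConstGame.conj_wn_eq_top hleft,
    ConstGame.conj_wn_eq_top hleft.conj_left, enumGame_wn_eq_top hleft.conj_left.conj_left,
    ConstGame.brec_wn_eq_top hleft.conj_left.conj_right, ConstGame.brec_wn_eq_top hleft.conj_right]
  exact ⟨⟨hbase, dup_wn_eq_top h hT⟩, merge_wn_eq_top h hT false⟩

end Winner

theorem Run.IsFair.longProduction_wn_eq_bot {T : Set (Set ℕ × Set ℕ)} {Γ : Run}
    (hΓ : Γ.IsFair (enumGame T).longProduction markingMoves) :
    (enumGame (forcedValues Γ)).longProduction.Wn Γ = .bot := by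
  have hlegal := (hΓ.change_enumGame (forcedValues Γ)).legal
  refine (Player.ne_iff_eq_neg (q := .top)).1 fun hwin => ?_
  have hantecedent :=
    longProductionAntecedent_wn_eq_top hlegal (fun _ _ hac ha => ha.tail hac) .refl
  have hsuccedent := (ConstGame.imp_wn_eq_top hlegal).1 hwin hantecedent
  obtain ⟨x, hx⟩ := hΓ.exists_value_succedent_notMem_forcedValues
  exact hx ((enumGame_wn_eq_top (hlegal.disj_right.thread x)).1
    ((ConstGame.brec_wn_eq_top hlegal.disj_right).1 hsuccedent x))

theorem HPM.exists_longProduction_lost (H : HPM) (e : Valuation) :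
    ∃ T Γ, H.Generates e Γ ∧ (enumGame T).longProduction.Wn Γ = .bot := by
  obtain ⟨Γ, hΓ, ⟨Φ, α, hprefix, hΦ, hα⟩ | hfair⟩ :=
    H.exists_fair_run e (enumGame ∅).longProduction markingMoves
  · exact ⟨∅, Γ, hΓ, ConstGame.wn_of_illegal _ Γ Φ _ hprefix hΦ hα⟩
  · exact ⟨forcedValues Γ, Γ, hΓ, hfair.longProduction_wn_eq_bot⟩

end CoL

theorem mainTheorem5 (P : ℕ) :
    ¬ CoL.UniformlyValid (CoL.Formula.longProduction (.letter P)) ∧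
    ∀ (H : CoL.HPM) (e : CoL.Valuation), ∃ A : CoL.ConstGame, A.Static ∧ A.IsEnumeration ∧
      ∃ Γ : CoL.Run, H.Generates e Γ ∧
        ((CoL.Formula.longProduction (.letter P)).interp (fun _ _ => A) e).Wn Γ =
          CoL.Player.bot := by
  have lost : ∀ (H : CoL.HPM) (e : CoL.Valuation), ∃ A : CoL.ConstGame, A.Static ∧
      A.IsEnumeration ∧ ∃ Γ : CoL.Run, H.Generates e Γ ∧
        ((CoL.Formula.longProduction (.letter P)).interp (fun _ _ => A) e).Wn Γ =
          CoL.Player.bot := by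
    intro H e
    obtain ⟨T, Γ, hΓ, hlost⟩ := H.exists_longProduction_lost e
    have henum := CoL.isEnumeration_enumGame T
    exact ⟨CoL.enumGame T, henum.static, henum, Γ, hΓ, hlost⟩
  refine ⟨fun ⟨H, hH⟩ => ?_, lost⟩
  obtain ⟨A, hstatic, -, Γ, hΓ, hlost⟩ := lost H fun _ => 0
  have hwon := hH ⟨fun _ _ => A, fun _ _ => hstatic⟩ _ Γ hΓ
  cases hlost.symm.trans hwon
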